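/- Let $p$ be a prime number and fix an isomorphism of fields $\mathbb{C}\simeq\overline{\mathbb{Q}}_p$, by which $\mathbb{Q}_p$ and $\mathbb{Z}_p$ are regarded as subsets of $\mathbb{C}$. Let $\mathfrak{h}$ be the upper half plane, $\rho=e^{2\pi i/3}$, and $$\mathcal{D}=\{z\in\mathfrak{h} : |z|>1,\ -\tfrac12\le \operatorname{Re} z<\tfrac12\}\cup\{e^{i\theta} : \theta\in[\tfrac{\pi}{2},\tfrac{2\pi}{3}]\}.$$ For $z\in\mathfrak{h}\cap\mathbb{Q}_p$ the $\{\infty,p\}$-continued fraction algorithm sets $x_1:=z$ and, for $k=1,2,\dots$, does the following. 1. (Initialization) If $x_k\in\mathbb{Z}_p$, set $z_k=x_k$, $\delta_k=+1$; otherwise set $z_k=-1/x_k$, $\delta_k=-1$. 2. ($p$-adic reduction) Determine $a_k\in\{0,\dots,p^2-1\}$ with $z_k-a_k\in p^2\mathbb{Z}_p$ and set $z_{k0}=(z_k-a_k)/p^2$. 3. ($\infty$-adic reduction) For $j=0,1,2,\dots$: if $z_{kj}\in\mathcal{D}$, set $x_{k+1}=z_{kj}$ and go to step 1 with $k+1$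 in place of $k$. If not, determine $b_{kj}\in\mathbb{Z}$ with $-\tfrac12\le\operatorname{Re}(z_{kj}-b_{kj})<\tfrac12$, except that if $z_{kj}\in\rho+\mathbb{Z}$ then $b_{kj}$ is determined by $z_{kj}-b_{kj}=\rho+1$; set $z_{k,j+1}=-1/(z_{kj}-b_{kj})$. **Theorem.** Let $z\in\mathfrak{h}\cap\mathbb{Q}_p$ be an imaginary quadratic irrational, i.e. algebraic of degree $2$ over $\mathbb{Q}$. Then the algorithm is well defined on $z$ (the $\infty$-adic reduction ends after finitely many steps for every $k\ge1$), and the $\{\infty,p\}$-continued fraction expansion of $z$ becomes periodic, that is, there exist integers $1\le k<l$ such that $x_k=x_l$. -/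

import Mathlib

noncomputable section

namespace InfPCF

/-- The standard fundamental domain `𝓓` of `SL₂(ℤ)` in the upper half plane:
`{z | |z| > 1, -1/2 ≤ Re z < 1/2} ∪ {e^{iθ} | θ ∈ [π/2, 2π/3]}`. -/
def fundDomain : Set ℂ :=
  {z | 0 < z.im ∧ 1 < ‖z‖ ∧ -(1 / 2 : ℝ) ≤ z.re ∧ z.re < 1 / 2} ∪
    {z | ∃ θ : ℝ, Real.pi / 2 ≤ θ ∧ θ ≤ 2 * Real.pi / 3 ∧ z = Complex.exp (θ * Complex.I)}

/-- The corner `ρ = e^{2πi/3}` of the fundamental domain. -/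
def rho : ℂ := Complex.exp (2 * Real.pi / 3 * Complex.I)

section

variable {p : ℕ} [Fact p.Prime]

/-- `z ∈ ℚ_p`, where `ℂ` is identified with the algebraic closure of `ℚ_p` along `ι`. -/
def MemQp (ι : ℂ ≃+* PadicAlgCl p) (z : ℂ) : Prop :=
  ∃ r : ℚ_[p], ι z = algebraMap ℚ_[p] (PadicAlgCl p) r

/-- `z ∈ ℤ_p`, where `ℂ` is identified with the algebraic closure of `ℚ_p` along `ι`. -/
def MemZp (ι : ℂ ≃+* PadicAlgCl p) (z : ℂ) : Prop :=
  ∃ r : ℤ_[p], ι z = algebraMap ℚ_[p] (PadicAlgCl p) (r : ℚ_[p])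

end

/-- The integer `b` by which `w` is translated in the archimedean reduction:
`-1/2 ≤ Re (w - b) < 1/2`, except on the translates `ρ + ℤ` of the corner, where the tie is
broken the other way, so that `w - b = ρ + 1` has real part `1/2`.
(On `ρ + ℤ` the inequalities alone would give `w - b = ρ`, `-1 / (w - b) = ρ + 1`, and the
reduction would run forever in the cycle `ρ + 1 ↦ ρ + 1`.) -/
def IsShift (w : ℂ) (b : ℤ) : Prop :=
  ((∀ n : ℤ, w ≠ rho + n) ∧ -(1 / 2 : ℝ) ≤ (w - b).re ∧ (w - b).re < 1 / 2) ∨ w - b = rho + 1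

/-- The record of a run of the algorithm; the loops are numbered `k = 1, 2, 3, …`, and the entries
with `k = 0` carry no information. -/
structure Run where
  /-- the complete quotients `x_k` -/
  x : ℕ → ℂ
  /-- the numbers `z_k` -/
  z : ℕ → ℂ
  /-- the signs `δ_k` -/
  δ : ℕ → ℤ
  /-- the `p`-adic digits `a_k` -/
  a : ℕ → ℕ
  /-- the number of inversions `w ↦ -1 / (w - b)` in the archimedean reduction of loop `k` -/
  m : ℕ → ℕ
  /-- the numbers `z_{kj}`, relevant for `j ≤ m k` -/
  w : ℕ → ℕ → ℂ
  /-- the integers `b_{kj}`, relevant for `j < m k` -/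
  b : ℕ → ℕ → ℤ

/-- `E` is the run of the `{∞, p}`-continued fraction algorithm on the input `z₀`. -/
structure IsExpansion {p : ℕ} [Fact p.Prime] (ι : ℂ ≃+* PadicAlgCl p) (z₀ : ℂ) (E : Run) :
    Prop where
  start : E.x 1 = z₀
  /-- initialization, `x_k ∈ ℤ_p` -/
  init_pos : ∀ k, 1 ≤ k → MemZp ι (E.x k) → E.δ k = 1 ∧ E.z k = E.x k
  /-- initialization, `x_k ∉ ℤ_p` -/
  init_neg : ∀ k, 1 ≤ k → ¬ MemZp ι (E.x k) → E.δ k = -1 ∧ E.z k = -1 / E.x k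
  /-- `p`-adic reduction: `a_k ∈ {0, …, p² - 1}` -/
  digit_lt : ∀ k, 1 ≤ k → E.a k < p ^ 2
  /-- `p`-adic reduction: `z_k - a_k ∈ p² ℤ_p` -/
  digit_modEq : ∀ k, 1 ≤ k → ∃ y : ℂ, MemZp ι y ∧ E.z k - E.a k = (p : ℂ) ^ 2 * y
  /-- `p`-adic reduction: `z_{k0} = (z_k - a_k) / p²` -/
  reduce_zero : ∀ k, 1 ≤ k → E.w k 0 = (E.z k - E.a k) / (p : ℂ) ^ 2
  /-- archimedean reduction: it goes on as long as `z_{kj} ∉ 𝓓` -/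
  reduce_not_mem : ∀ k, 1 ≤ k → ∀ j < E.m k, E.w k j ∉ fundDomain
  /-- archimedean reduction: choice of `b_{kj}` -/
  reduce_shift : ∀ k, 1 ≤ k → ∀ j < E.m k, IsShift (E.w k j) (E.b k j)
  /-- archimedean reduction: `z_{k,j+1} = -1 / (z_{kj} - b_{kj})` -/
  reduce_succ : ∀ k, 1 ≤ k → ∀ j < E.m k, E.w k (j + 1) = -1 / (E.w k j - E.b k j)
  /-- archimedean reduction: it stops in `𝓓` -/
  reduce_mem : ∀ k, 1 ≤ k → E.w k (E.m k) ∈ fundDomain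
  /-- the next complete quotient -/
  next : ∀ k, 1 ≤ k → E.x (k + 1) = E.w k (E.m k)

end InfPCF

end

namespace InfPCF

/-! Every step of the algorithm preserves the discriminant `D` of an integral form with root `z`.
Translations and `w ↦ -1 / w` are unimodular; for the `p`-adic step see `IsFormRoot.digit`. From
`x_2` on, the complete quotients lie in `fundDomain`, where only finitely many roots of discriminant
`D` exist (`finite_reduced`), so two of them coincide. Each archimedean reduction stops because the
leading coefficient is a positive integer which drops whenever the translate lies inside the unit
disc; outside it, very few steps remain (`IsFormRoot.reduces`). -/

/-- `z` is the root in the upper half plane of a positive definite integral binary quadratic form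
of discriminant `D` and leading coefficient `A`. -/
def IsFormRoot (D A : ℤ) (z : ℂ) : Prop :=
  0 < z.im ∧ 0 < A ∧ ∃ B C : ℤ, B ^ 2 - 4 * A * C = D ∧ (A : ℂ) * z ^ 2 + B * z + C = 0

/-! ### Integral forms under translation and inversion -/

lemma re_im_of_root {A B C : ℤ} {z : ℂ} (hz : 0 < z.im)
    (h : (A : ℂ) * z ^ 2 + B * z + C = 0) :
    (B : ℝ) = -2 * A * z.re ∧ (C : ℝ) = A * (z.re ^ 2 + z.im ^ 2) := by
  have h1 := congrArg Complex.re h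
  have h2 := congrArg Complex.im h
  simp [pow_two] at h1 h2
  have h3 : (B : ℝ) = -2 * A * z.re := by
    have : z.im * (B + 2 * A * z.re) = 0 := by linarith
    rcases mul_eq_zero.1 this with h | h
    · exact absurd h hz.ne'
    · linarith
  exact ⟨h3, by rw [h3] at h1; linarith⟩

lemma sq_norm (z : ℂ) : ‖z‖ ^ 2 = z.re ^ 2 + z.im ^ 2 := by
  rw [Complex.sq_norm, Complex.normSq_apply]; ring

lemma ne_zero_of_im_pos {z : ℂ} (hz : 0 < z.im) : z ≠ 0 := by
  rintro rfl; simp at hz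

lemma re_neg_one_div (z : ℂ) : (-1 / z).re = -z.re / (z.re ^ 2 + z.im ^ 2) := by
  rw [neg_div, one_div, Complex.neg_re, Complex.inv_re, Complex.normSq_apply]; ring

lemma im_neg_one_div (z : ℂ) : (-1 / z).im = z.im / (z.re ^ 2 + z.im ^ 2) := by
  rw [neg_div, one_div, Complex.neg_im, Complex.inv_im, Complex.normSq_apply]; ring

lemma neg_one_div_neg_one_div (z : ℂ) : -1 / (-1 / z) = z := by
  rw [neg_div, neg_div, div_neg, neg_neg, one_div_one_div]

lemma IsFormRoot.sub_int {D A : ℤ} {z : ℂ} (h : IsFormRoot D A z) (b : ℤ) :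
    IsFormRoot D A (z - b) := by
  obtain ⟨hz, hA, B, C, hD, h⟩ := h
  refine ⟨by simpa using hz, hA, 2 * A * b + B, A * b ^ 2 + B * b + C, by rw [← hD]; ring, ?_⟩
  push_cast
  linear_combination h

/-- The new leading coefficient is the old constant term, which is `A * |z|²` by Vieta for the pair
of conjugate roots. This formula drives the termination argument. -/
lemma IsFormRoot.neg_one_div {D A : ℤ} {z : ℂ} (h : IsFormRoot D A z) :
    ∃ A' : ℤ, (A' : ℝ) = A * (z.re ^ 2 + z.im ^ 2) ∧ IsFormRoot D A' (-1 / z) := by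
  obtain ⟨hz, hA, B, C, hD, h⟩ := h
  have hC := (re_im_of_root hz h).2
  have hA' : (0 : ℝ) < A := by exact_mod_cast hA
  have hz0 := ne_zero_of_im_pos hz
  refine ⟨C, hC, ?_, ?_, -B, A, by rw [← hD]; ring, ?_⟩
  · rw [im_neg_one_div]; positivity
  · have : (0 : ℝ) < C := by rw [hC]; positivity
    exact_mod_cast this
  · push_cast
    field_simp
    linear_combination h

lemma exists_isFormRoot {z : ℂ} (hz : 0 < z.im) (h : (minpoly ℚ z).natDegree = 2) :
    ∃ D A : ℤ, IsFormRoot D A z := by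
  have h0 : minpoly ℚ z ≠ 0 := by intro h'; simp [h'] at h
  have hint : IsIntegral ℚ z := minpoly.ne_zero_iff.1 h0
  have hr := minpoly.aeval ℚ z
  have hm := minpoly.monic hint
  have hc : (minpoly ℚ z).coeff 2 = 1 := by rw [← h]; exact hm
  rw [Polynomial.aeval_eq_sum_range, h] at hr
  simp only [Finset.sum_range_succ, Finset.sum_range_zero, hc] at hr
  set s := (minpoly ℚ z).coeff 0
  set t := (minpoly ℚ z).coeff 1
  have hs : (s : ℂ) * s.den = s.num := by exact_mod_cast s.mul_den_eq_num
  have ht : (t : ℂ) * t.den = t.num := by exact_mod_cast t.mul_den_eq_num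
  -- Clearing denominators need not give a primitive form: any fixed `D` serves.
  refine ⟨_, s.den * t.den, hz, ?_, t.num * s.den, s.num * t.den, rfl, ?_⟩
  · have := s.den_pos
    have := t.den_pos
    positivity
  · simp only [Algebra.smul_def, eq_ratCast] at hr
    push_cast at hr ⊢
    rw [← hs, ← ht]
    linear_combination (s.den : ℂ) * t.den * hr

/-! ### The `p`-adic step -/

section Padic

variable {p : ℕ} [Fact p.Prime] {ι : ℂ ≃+* PadicAlgCl p}

lemma MemZp.memQp {z : ℂ} (h : MemZp ι z) : MemQp ι z := by
  obtain ⟨r, hr⟩ := h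
  exact ⟨r, hr⟩

lemma memZp_intCast (n : ℤ) : MemZp ι n := ⟨n, by simp⟩

lemma MemZp.add {x y : ℂ} (hx : MemZp ι x) (hy : MemZp ι y) : MemZp ι (x + y) := by
  obtain ⟨r, hr⟩ := hx
  obtain ⟨s, hs⟩ := hy
  exact ⟨r + s, by rw [map_add, hr, hs]; simp⟩

lemma MemZp.mul {x y : ℂ} (hx : MemZp ι x) (hy : MemZp ι y) : MemZp ι (x * y) := by
  obtain ⟨r, hr⟩ := hx
  obtain ⟨s, hs⟩ := hy
  exact ⟨r * s, by rw [map_mul, hr, hs]; simp⟩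

lemma MemQp.sub_int {x : ℂ} (hx : MemQp ι x) (n : ℤ) : MemQp ι (x - n) := by
  obtain ⟨r, hr⟩ := hx
  exact ⟨r - n, by rw [map_sub, hr]; simp⟩

lemma MemQp.neg_one_div {x : ℂ} (hx : MemQp ι x) : MemQp ι (-1 / x) := by
  obtain ⟨r, hr⟩ := hx
  exact ⟨-1 / r, by rw [map_div₀, hr]; simp⟩

lemma MemQp.memZp_neg_one_div {x : ℂ} (hx : MemQp ι x) (h : ¬ MemZp ι x) :
    MemZp ι (-1 / x) := by
  obtain ⟨r, hr⟩ := hx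
  have h1 : 1 < ‖r‖ := by
    by_contra h1
    exact h ⟨⟨r, not_lt.1 h1⟩, hr⟩
  refine ⟨⟨-1 / r, ?_⟩, by rw [map_div₀, hr]; simp⟩
  rw [norm_div, norm_neg, norm_one]
  exact (div_le_one (by linarith)).2 h1.le

lemma MemZp.exists_digit {x : ℂ} (hx : MemZp ι x) :
    ∃ a : ℕ, a < p ^ 2 ∧ ∃ y : ℂ, MemZp ι y ∧ x - a = (p : ℂ) ^ 2 * y := by
  obtain ⟨r, hr⟩ := hx
  obtain ⟨s, hs⟩ := Ideal.mem_span_singleton.1 (PadicInt.appr_spec 2 r)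
  refine ⟨r.appr 2, r.appr_lt 2, ι.symm (algebraMap ℚ_[p] (PadicAlgCl p) s),
    ⟨s, by simp⟩, ι.injective ?_⟩
  have hs' : (r : ℚ_[p]) - (r.appr 2 : ℕ) = (p : ℚ_[p]) ^ 2 * s := by
    exact_mod_cast congrArg (fun t : ℤ_[p] => (t : ℚ_[p])) hs
  have := congrArg (algebraMap ℚ_[p] (PadicAlgCl p)) hs'
  simp only [map_sub, map_mul, map_pow, map_natCast] at this
  simp [hr, this]

lemma dvd_of_eq_mul_memZp {n : ℤ} {y : ℂ} (hy : MemZp ι y) (h : (n : ℂ) = (p : ℂ) ^ 2 * y) :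
    (p : ℤ) ^ 2 ∣ n := by
  obtain ⟨s, hs⟩ := hy
  have h1 := congrArg ι h
  rw [map_mul, hs] at h1
  have h2 : algebraMap ℚ_[p] (PadicAlgCl p) (n : ℚ_[p]) =
      algebraMap ℚ_[p] (PadicAlgCl p) ((p : ℚ_[p]) ^ 2 * s) := by simpa using h1
  have h3 : (n : ℤ_[p]) = (p : ℤ_[p]) ^ 2 * s := by
    apply Subtype.ext
    have := (algebraMap ℚ_[p] (PadicAlgCl p)).injective h2
    push_cast
    exact this
  exact (PadicInt.pow_p_dvd_int_iff 2 n).1 ⟨s, h3⟩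

/-- The `p`-adic reduction preserves the discriminant, since `f(a) ∈ p² ℤ` when `z ≡ a` modulo
`p²` is a root of `f`. -/
lemma IsFormRoot.digit {D A : ℤ} {z y : ℂ} {a : ℕ} (h : IsFormRoot D A z) (hy : MemZp ι y)
    (hza : z - a = (p : ℂ) ^ 2 * y) : IsFormRoot D (A * p ^ 2) ((z - a) / (p : ℂ) ^ 2) := by
  obtain ⟨hz, hA, B, C, hD, h⟩ := h
  have hp : (0 : ℤ) < p := by exact_mod_cast (Fact.out : p.Prime).pos
  have hp' : (p : ℂ) ≠ 0 := by exact_mod_cast hp.ne'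
  have hy' : (z - a) / (p : ℂ) ^ 2 = y := by rw [hza]; field_simp
  have hzy : z = a + (p : ℂ) ^ 2 * y := by linear_combination hza
  -- Expanding `f(a + p² y) = 0` gives `f(a) = p² * y * (-A (2a + p² y) - B)`, and `ℤ ∩ p² ℤ_p = p²
  -- ℤ`.
  obtain ⟨c, hc⟩ : (p : ℤ) ^ 2 ∣ A * a ^ 2 + B * a + C := by
    have hm : MemZp ι (y * ((-A * (2 * a + p ^ 2 * y) - B))) := by
      have h1 : MemZp ι ((((-A * 2 * a - B : ℤ)) : ℂ) + ((-A * p ^ 2 : ℤ) : ℂ) * y) :=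
        (memZp_intCast _).add ((memZp_intCast _).mul hy)
      convert hy.mul h1 using 2
      push_cast
      ring
    refine dvd_of_eq_mul_memZp hm ?_
    rw [hzy] at h
    push_cast
    linear_combination h
  have hc' : (A : ℂ) * a ^ 2 + B * a + C = p ^ 2 * c := by exact_mod_cast hc
  rw [hy']
  have him : z.im = (p : ℝ) ^ 2 * y.im := by
    rw [hzy]
    have : ((p : ℂ) ^ 2 * y).im = (p : ℝ) ^ 2 * y.im := by
      have : (p : ℂ) ^ 2 = (((p : ℝ) ^ 2 : ℝ) : ℂ) := by push_cast; rfl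
      rw [this, Complex.im_ofReal_mul]
    simp [this]
  -- These are the coefficients of `f(a + p² Y) / p²`.
  refine ⟨?_, by positivity, 2 * A * a + B, c, ?_, ?_⟩
  · rw [him] at hz
    exact pos_of_mul_pos_right hz (by positivity)
  · rw [← hD]
    linear_combination 4 * A * hc
  · rw [hzy] at h
    have : (p : ℂ) ^ 2 * ((A * p ^ 2 : ℤ) * y ^ 2 + (2 * A * a + B : ℤ) * y + c) = 0 := by
      push_cast
      linear_combination h - hc'
    exact (mul_eq_zero.1 this).resolve_left (pow_ne_zero _ hp')

lemma MemZp.memQp_digit {z y : ℂ} {a : ℕ} (hy : MemZp ι y)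
    (hza : z - a = (p : ℂ) ^ 2 * y) : MemQp ι ((z - a) / (p : ℂ) ^ 2) := by
  have hp' : (p : ℂ) ≠ 0 := by exact_mod_cast (Fact.out : p.Prime).ne_zero
  have hy' : (z - a) / (p : ℂ) ^ 2 = y := by rw [hza]; field_simp
  rw [hy']
  exact hy.memQp

end Padic

/-! ### Geometry of the fundamental domain -/

lemma cos_two_pi_div_three : Real.cos (2 * Real.pi / 3) = -(1 / 2) := by
  rw [show 2 * Real.pi / 3 = Real.pi - Real.pi / 3 by ring, Real.cos_pi_sub, Real.cos_pi_div_three]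

lemma rho_re : rho.re = -(1 / 2) := by
  rw [rho, show (2 * Real.pi / 3 * Complex.I : ℂ) = ((2 * Real.pi / 3 : ℝ) : ℂ) * Complex.I by
    push_cast; rfl, Complex.exp_ofReal_mul_I_re, cos_two_pi_div_three]

lemma rho_im_pos : 0 < rho.im := by
  rw [rho, show (2 * Real.pi / 3 * Complex.I : ℂ) = ((2 * Real.pi / 3 : ℝ) : ℂ) * Complex.I by
    push_cast; rfl, Complex.exp_ofReal_mul_I_im]
  have := Real.pi_pos
  exact Real.sin_pos_of_pos_of_lt_pi (by linarith) (by linarith)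

lemma norm_rho : ‖rho‖ = 1 := by
  rw [rho, show (2 * Real.pi / 3 * Complex.I : ℂ) = ((2 * Real.pi / 3 : ℝ) : ℂ) * Complex.I by
    push_cast; rfl, Complex.norm_exp_ofReal_mul_I]

lemma rho_sq : rho.re ^ 2 + rho.im ^ 2 = 1 := by
  rw [← sq_norm, norm_rho, one_pow]

lemma eq_rho {u : ℂ} (him : 0 < u.im) (hre : u.re = -(1 / 2))
    (h : u.re ^ 2 + u.im ^ 2 = 1) : u = rho := by
  apply Complex.ext
  · rw [hre, rho_re]
  · have h1 := rho_sq
    rw [rho_re] at h1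
    rw [hre] at h
    have h2 := rho_im_pos
    nlinarith

lemma bounds_of_mem_fundDomain {z : ℂ} (h : z ∈ fundDomain) :
    |z.re| ≤ 1 / 2 ∧ 1 ≤ z.re ^ 2 + z.im ^ 2 := by
  rw [← sq_norm]
  rcases h with ⟨-, h1, h2, h3⟩ | ⟨θ, h1, h2, rfl⟩
  · exact ⟨abs_le.2 ⟨h2, h3.le⟩, by nlinarith⟩
  · rw [Complex.norm_exp_ofReal_mul_I, Complex.exp_ofReal_mul_I_re]
    have hpi := Real.pi_pos
    refine ⟨abs_le.2 ⟨?_, ?_⟩, by norm_num⟩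
    · rw [← cos_two_pi_div_three]
      exact Real.cos_le_cos_of_nonneg_of_le_pi (by linarith) (by linarith) h2
    · have : Real.cos θ ≤ 0 := Real.cos_nonpos_of_pi_div_two_le_of_le h1 (by linarith)
      linarith

lemma mem_fundDomain_of_arc {z : ℂ} (him : 0 < z.im) (h : z.re ^ 2 + z.im ^ 2 = 1)
    (h1 : -(1 / 2) ≤ z.re) (h2 : z.re ≤ 0) : z ∈ fundDomain := by
  right
  have hpi := Real.pi_pos
  refine ⟨Real.arccos z.re, ?_, ?_, ?_⟩
  · rw [← Real.arccos_zero]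
    exact Real.arccos_le_arccos h2
  · rw [← Real.arccos_cos (x := 2 * Real.pi / 3) (by linarith) (by linarith),
      cos_two_pi_div_three]
    exact Real.arccos_le_arccos h1
  · apply Complex.ext
    · rw [Complex.exp_ofReal_mul_I_re, Real.cos_arccos] <;> linarith
    · rw [Complex.exp_ofReal_mul_I_im, Real.sin_arccos,
        show 1 - z.re ^ 2 = z.im ^ 2 by linarith, Real.sqrt_sq him.le]

lemma exists_isShift (w : ℂ) : ∃ b : ℤ, IsShift w b := by
  by_cases h : ∃ n : ℤ, w = rho + n
  · obtain ⟨n, rfl⟩ := h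
    exact ⟨n - 1, Or.inr (by push_cast; ring)⟩
  · push Not at h
    refine ⟨⌊w.re + 1 / 2⌋, Or.inl ⟨h, ?_, ?_⟩⟩
    · have := Int.floor_le (w.re + 1 / 2)
      simp only [Complex.sub_re, Complex.intCast_re]
      linarith
    · have := Int.lt_floor_add_one (w.re + 1 / 2)
      simp only [Complex.sub_re, Complex.intCast_re]
      linarith

/-! ### Termination of the archimedean reduction -/

/-- The archimedean reduction can be run on `w`, and ends after finitely many steps. -/
inductive Reduces : ℂ → Prop
  | mem {w : ℂ} (h : w ∈ fundDomain) : Reduces w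
  | step {w : ℂ} (b : ℤ) (hw : w ∉ fundDomain) (hb : IsShift w b)
      (h : Reduces (-1 / (w - b))) : Reduces w

/-- Once the translate `u` lies outside the open unit disc, at most two further inversions lead
into the fundamental domain. -/
lemma reduces_neg_one_div {u : ℂ} (him : 0 < u.im) (h : 1 ≤ u.re ^ 2 + u.im ^ 2)
    (h1 : -(1 / 2) ≤ u.re) (h2 : u.re < 1 / 2) (hu : u ≠ rho) : Reduces (-1 / u) := by
  by_cases hv : -1 / u ∈ fundDomain
  · exact .mem hv
  have hpos : 0 < u.re ^ 2 + u.im ^ 2 := by linarith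
  have hvre := re_neg_one_div u
  have hvim := im_neg_one_div u
  -- `Re (-1 / u) = -Re u / |u|²` with `|u| ≥ 1`; the value `1 / 2` would force `u = rho`.
  have hlt : -(1 / 2) < (-1 / u).re ∧ (-1 / u).re < 1 / 2 := by
    rw [hvre, lt_div_iff₀ hpos, div_lt_iff₀ hpos]
    refine ⟨by linarith, ?_⟩
    rcases h1.eq_or_lt with h1 | h1
    · rcases h.eq_or_lt with h | h
      · exact absurd (eq_rho him h1.symm h.symm) hu
      · linarith
    · linarith
  have hmem : u ∈ fundDomain := by
    rcases h.eq_or_lt with h | h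
    -- On the unit circle inversion is `Re ↦ -Re`, so either `u` or `-1 / u` is on the arc, and the
    -- latter is excluded by `hv`.
    · by_cases hre : u.re ≤ 0
      · exact mem_fundDomain_of_arc him h.symm h1 hre
      · rw [← h, div_one] at hvre hvim
        refine absurd (mem_fundDomain_of_arc ?_ ?_ ?_ ?_) hv
        · rwa [hvim]
        · rw [hvre, hvim, h]; ring
        · exact hlt.1.le
        · rw [hvre]; linarith
    · refine Or.inl ⟨him, ?_, h1, h2⟩
      rw [← sq_norm] at h
      nlinarith [norm_nonneg u]
  -- By the strict bounds the shift of `-1 / u` is `0`, and inverting again returns to `u`.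
  refine .step 0 hv (Or.inl ⟨?_, ?_, ?_⟩) ?_
  · intro n hn
    have hre := congrArg Complex.re hn
    rw [Complex.add_re, rho_re, Complex.intCast_re] at hre
    rw [hre] at hlt
    have h3 : (0 : ℝ) < n := by linarith
    have h4 : (n : ℝ) < 1 := by linarith
    norm_cast at h3 h4
    omega
  · simpa using hlt.1.le
  · simpa using hlt.2
  · rw [Int.cast_zero, sub_zero, neg_one_div_neg_one_div]
    exact .mem hmem

/-- If `|w - b| < 1`, the leading coefficient falls to `A * |w - b|²` and `ih` applies. The
exceptional shift ends at once, since `-1 / (rho + 1) = rho`. -/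
lemma reduces_of_isShift {D A : ℤ} {w : ℂ} {b : ℤ} (hr : IsFormRoot D A w) (hb : IsShift w b)
    (ih : ∀ (A' : ℤ) (v : ℂ), A' < A → IsFormRoot D A' v → Reduces v) :
    Reduces (-1 / (w - b)) := by
  have hu := hr.sub_int b
  rcases hb with ⟨h, h1, h2⟩ | h
  · by_cases hn : 1 ≤ (w - b).re ^ 2 + (w - b).im ^ 2
    · exact reduces_neg_one_div hu.1 hn h1 h2
        fun h' => h b (by rw [← h']; ring)
    · obtain ⟨A', hA', hr'⟩ := hu.neg_one_div
      refine ih A' _ ?_ hr'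
      have hA : (0 : ℝ) < A := by exact_mod_cast hr.2.1
      have : (A' : ℝ) < A := by
        rw [hA']
        exact mul_lt_of_lt_one_right hA (not_le.1 hn)
      exact_mod_cast this
  · have hs := rho_sq
    rw [rho_re] at hs
    have : (rho + 1).re ^ 2 + (rho + 1).im ^ 2 = 1 := by
      simp [rho_re]
      linarith
    have hre := re_neg_one_div (rho + 1)
    have him := im_neg_one_div (rho + 1)
    rw [this, div_one] at hre him
    simp only [Complex.add_re, Complex.add_im, Complex.one_re, Complex.one_im, rho_re] at hre him
    rw [h]
    have hp := rho_im_pos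
    refine .mem (mem_fundDomain_of_arc ?_ ?_ ?_ ?_)
    · rw [him]; linarith
    · rw [hre, him]; linarith
    · rw [hre]; norm_num
    · rw [hre]; norm_num

lemma IsFormRoot.reduces {D A : ℤ} {w : ℂ} (h : IsFormRoot D A w) : Reduces w := by
  obtain ⟨n, hn⟩ : ∃ n : ℕ, A = n := ⟨A.toNat, (Int.toNat_of_nonneg h.2.1.le).symm⟩
  induction n using Nat.strong_induction_on generalizing A w with
  | _ n ih =>
    by_cases hw : w ∈ fundDomain
    · exact .mem hw
    obtain ⟨b, hb⟩ := exists_isShift w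
    refine .step b hw hb (reduces_of_isShift h hb fun A' v hA' hv => ?_)
    have := hv.2.1
    exact ih A'.toNat (by omega) hv (by omega)

lemma Reduces.exists_sequence {w : ℂ} (h : Reduces w) :
    ∃ (m : ℕ) (v : ℕ → ℂ) (b : ℕ → ℤ), v 0 = w ∧ (∀ j < m, v j ∉ fundDomain) ∧
      (∀ j < m, IsShift (v j) (b j)) ∧ (∀ j < m, v (j + 1) = -1 / (v j - b j)) ∧
      v m ∈ fundDomain := by
  induction h with
  | @mem w h => exact ⟨0, fun _ => w, fun _ => 0, rfl, by simp, by simp, by simp, h⟩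
  | @step w c hw hc _ ih =>
    obtain ⟨m, v, b, h0, h1, h2, h3, h4⟩ := ih
    refine ⟨m + 1, fun j => Nat.casesOn j w v, fun j => Nat.casesOn j c b, rfl, ?_, ?_, ?_, h4⟩
    · rintro (_ | j) hj
      · exact hw
      · exact h1 j (by omega)
    · rintro (_ | j) hj
      · exact hc
      · exact h2 j (by omega)
    · rintro (_ | j) hj
      · exact h0
      · exact h3 j (by omega)

lemma exists_isFormRoot_of_sequence {D A : ℤ} {m : ℕ} {v : ℕ → ℂ} {b : ℕ → ℤ}
    (h0 : IsFormRoot D A (v 0)) (h : ∀ j < m, v (j + 1) = -1 / (v j - b j)) :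
    ∃ A' : ℤ, IsFormRoot D A' (v m) := by
  induction m with
  | zero => exact ⟨A, h0⟩
  | succ m ih =>
    obtain ⟨A', hA'⟩ := ih fun j hj => h j (by omega)
    obtain ⟨A'', -, hA''⟩ := (hA'.sub_int (b m)).neg_one_div
    exact ⟨A'', by rw [h m (by omega)]; exact hA''⟩

/-! ### Finiteness of reduced roots -/

/-- There are only finitely many reduced numbers of a given discriminant. -/
lemma finite_reduced (D : ℤ) : {z : ℂ | z ∈ fundDomain ∧ ∃ A : ℤ, IsFormRoot D A z}.Finite := by
  -- Given `D`, the pair `(A, B)` determines the root in the upper half plane.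
  refine (((Set.finite_Icc (-|D|) |D|).prod (Set.finite_Icc (-|D|) |D|)).image
    fun q : ℤ × ℤ => (⟨-q.2 / (2 * q.1), √(-D) / (2 * q.1)⟩ : ℂ)).subset ?_
  rintro z ⟨hz, A, him, hA, B, C, hD, h⟩
  obtain ⟨hre, hn⟩ := bounds_of_mem_fundDomain hz
  obtain ⟨hB, hC⟩ := re_im_of_root him h
  have hA' : (0 : ℝ) < A := by exact_mod_cast hA
  have hAC : A ≤ C := by
    have : (A : ℝ) ≤ C := by rw [hC]; nlinarith
    exact_mod_cast this
  have hBA : |B| ≤ A := by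
    have : |(B : ℝ)| ≤ A := by
      rw [hB, abs_mul, abs_mul, abs_of_pos hA']
      norm_num
      nlinarith
    exact_mod_cast this
  -- `-D = 4AC - B² ≥ 3A² ≥ A`, from `|B| ≤ A ≤ C`.
  have hDA : A ≤ |D| := by
    have h1 : B ^ 2 ≤ A ^ 2 := sq_le_sq.2 (by rwa [abs_of_pos hA])
    have h2 := neg_abs_le D
    nlinarith
  have hDr : (-D : ℝ) = (2 * A * z.im) ^ 2 := by
    have : (D : ℝ) = B ^ 2 - 4 * A * C := by rw [← hD]; push_cast; ring
    rw [this, hB, hC]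
    ring
  refine ⟨(A, B), ⟨⟨by omega, hDA⟩, ?_⟩, ?_⟩
  · exact abs_le.1 (hBA.trans hDA)
  · apply Complex.ext
    · simp only [hB]
      field_simp
    · simp only [hDr]
      rw [Real.sqrt_sq (by positivity)]
      field_simp

/-! ### Periodicity and existence of the expansion -/

section Expansion

variable {p : ℕ} [Fact p.Prime] {ι : ℂ ≃+* PadicAlgCl p}

lemma IsExpansion.exists_isFormRoot {z : ℂ} {E : Run} (hE : IsExpansion ι z E) {D A : ℤ}
    (h : IsFormRoot D A z) {k : ℕ} (hk : 1 ≤ k) : ∃ A' : ℤ, IsFormRoot D A' (E.x k) := by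
  induction k, hk using Nat.le_induction with
  | base => exact ⟨A, by rwa [hE.start]⟩
  | succ k hk ih =>
    obtain ⟨A₁, h₁⟩ := ih
    obtain ⟨A₂, h₂⟩ : ∃ A₂ : ℤ, IsFormRoot D A₂ (E.z k) := by
      by_cases hx : MemZp ι (E.x k)
      · exact ⟨A₁, by rwa [(hE.init_pos k hk hx).2]⟩
      · obtain ⟨A₂, -, h₂⟩ := h₁.neg_one_div
        exact ⟨A₂, by rwa [(hE.init_neg k hk hx).2]⟩
    obtain ⟨y, hy, hzy⟩ := hE.digit_modEq k hk
    have h₃ := h₂.digit hy hzy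
    rw [← hE.reduce_zero k hk] at h₃
    rw [hE.next k hk]
    exact exists_isFormRoot_of_sequence h₃ (hE.reduce_succ k hk)

lemma IsExpansion.exists_eq {z : ℂ} {E : Run} (hE : IsExpansion ι z E) {D A : ℤ}
    (h : IsFormRoot D A z) : ∃ k l : ℕ, 1 ≤ k ∧ k < l ∧ E.x k = E.x l := by
  -- The offset is `2` because `x_1` is the input, which need not be reduced.
  have hmaps : ∀ k, E.x (k + 2) ∈ {z : ℂ | z ∈ fundDomain ∧ ∃ A : ℤ, IsFormRoot D A z} := by
    intro k
    refine ⟨?_, hE.exists_isFormRoot h (by omega)⟩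
    rw [hE.next (k + 1) (by omega)]
    exact hE.reduce_mem (k + 1) (by omega)
  obtain ⟨k, l, hkl, heq⟩ := (finite_reduced D).exists_lt_map_eq_of_forall_mem hmaps
  exact ⟨k + 2, l + 2, by omega, by omega, heq⟩

/-- The data of one loop of the algorithm, with the names of `Run`. -/
structure Loop where
  z : ℂ
  δ : ℤ
  a : ℕ
  m : ℕ
  w : ℕ → ℂ
  b : ℕ → ℤ

/-- `L` is the loop of the algorithm with input `x`. -/
structure IsLoop (ι : ℂ ≃+* PadicAlgCl p) (x : ℂ) (L : Loop) : Prop where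
  init_pos : MemZp ι x → L.δ = 1 ∧ L.z = x
  init_neg : ¬ MemZp ι x → L.δ = -1 ∧ L.z = -1 / x
  digit_lt : L.a < p ^ 2
  digit_modEq : ∃ y : ℂ, MemZp ι y ∧ L.z - L.a = (p : ℂ) ^ 2 * y
  reduce_zero : L.w 0 = (L.z - L.a) / (p : ℂ) ^ 2
  reduce_not_mem : ∀ j < L.m, L.w j ∉ fundDomain
  reduce_shift : ∀ j < L.m, IsShift (L.w j) (L.b j)
  reduce_succ : ∀ j < L.m, L.w (j + 1) = -1 / (L.w j - L.b j)
  reduce_mem : L.w L.m ∈ fundDomain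

lemma memQp_of_sequence {m : ℕ} {v : ℕ → ℂ} {b : ℕ → ℤ} (h0 : MemQp ι (v 0))
    (h : ∀ j < m, v (j + 1) = -1 / (v j - b j)) : MemQp ι (v m) := by
  induction m with
  | zero => exact h0
  | succ m ih =>
    rw [h m (by omega)]
    exact ((ih fun j hj => h j (by omega)).sub_int (b m)).neg_one_div

/-- Both properties of `x` pass to the output, so loops can be chained. Membership in `ℚ_p` ensures
that `-1 / x` is in `ℤ_p` when `x` is not. -/
lemma exists_isLoop {x : ℂ} {D A : ℤ} (hx : IsFormRoot D A x) (hxp : MemQp ι x) :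
    ∃ L : Loop, IsLoop ι x L ∧ (∃ A' : ℤ, IsFormRoot D A' (L.w L.m)) ∧ MemQp ι (L.w L.m) := by
  obtain ⟨δ, z, hpos, hneg, ⟨A₁, hz⟩, hzp⟩ : ∃ (δ : ℤ) (z : ℂ),
      (MemZp ι x → δ = 1 ∧ z = x) ∧ (¬ MemZp ι x → δ = -1 ∧ z = -1 / x) ∧
      (∃ A' : ℤ, IsFormRoot D A' z) ∧ MemZp ι z := by
    by_cases h : MemZp ι x
    · exact ⟨1, x, fun _ => ⟨rfl, rfl⟩, fun h' => absurd h h', ⟨A, hx⟩, h⟩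
    · obtain ⟨A', -, hA'⟩ := hx.neg_one_div
      exact ⟨-1, -1 / x, fun h' => absurd h' h, fun _ => ⟨rfl, rfl⟩, ⟨A', hA'⟩,
        hxp.memZp_neg_one_div h⟩
  obtain ⟨a, ha, y, hy, hzy⟩ := hzp.exists_digit
  have hw := hz.digit hy hzy
  have hwp := hy.memQp_digit hzy
  obtain ⟨m, v, b, h0, h1, h2, h3, h4⟩ := hw.reduces.exists_sequence
  rw [← h0] at hw hwp
  exact ⟨⟨z, δ, a, m, v, b⟩, ⟨hpos, hneg, ha, ⟨y, hy, hzy⟩, h0, h1, h2, h3, h4⟩,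
    exists_isFormRoot_of_sequence hw h3, memQp_of_sequence hwp h3⟩

lemma exists_isExpansion {z : ℂ} {D A : ℤ} (hz : IsFormRoot D A z) (hzp : MemQp ι z) :
    ∃ E : Run, IsExpansion ι z E := by
  let S := {x : ℂ // (∃ A : ℤ, IsFormRoot D A x) ∧ MemQp ι x}
  have hL (s : S) : ∃ L : Loop, IsLoop ι s.1 L ∧ (∃ A' : ℤ, IsFormRoot D A' (L.w L.m)) ∧
      MemQp ι (L.w L.m) := by
    obtain ⟨A', hA'⟩ := s.2.1
    exact exists_isLoop hA' s.2.2
  choose L hL hS using hL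
  -- Loops are numbered from `1`, hence the exponent `k - 1`; `X 0 = X 1` is a dummy value.
  let X : ℕ → S := fun k => (fun s : S => (⟨(L s).w (L s).m, hS s⟩ : S))^[k - 1] ⟨z, ⟨A, hz⟩, hzp⟩
  have hX (k : ℕ) (hk : 1 ≤ k) : (X (k + 1)).1 = (L (X k)).w (L (X k)).m := by
    obtain ⟨k, rfl⟩ := Nat.exists_eq_add_of_le' hk
    simp only [X, Nat.add_sub_cancel, Function.iterate_succ_apply']
  exact ⟨⟨fun k => (X k).1, fun k => (L (X k)).z, fun k => (L (X k)).δ, fun k => (L (X k)).a,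
    fun k => (L (X k)).m, fun k => (L (X k)).w, fun k => (L (X k)).b⟩,
    { start := rfl
      init_pos := fun k _ => (hL (X k)).init_pos
      init_neg := fun k _ => (hL (X k)).init_neg
      digit_lt := fun k _ => (hL (X k)).digit_lt
      digit_modEq := fun k _ => (hL (X k)).digit_modEq
      reduce_zero := fun k _ => (hL (X k)).reduce_zero
      reduce_not_mem := fun k _ => (hL (X k)).reduce_not_mem
      reduce_shift := fun k _ => (hL (X k)).reduce_shift
      reduce_succ := fun k _ => (hL (X k)).reduce_succ
      reduce_mem := fun k _ => (hL (X k)).reduce_mem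
      next := hX }⟩

end Expansion

end InfPCF

/-- For every field isomorphism `ι` of `ℂ` with the algebraic closure of `ℚ_p` and every imaginary
quadratic irrational `z` in the upper half plane that lies in `ℚ_p`, the `{∞, p}`-continued
fraction algorithm runs forever on `z` (every archimedean reduction terminates), and its complete
quotients satisfy `x_k = x_l` for some `1 ≤ k < l`. -/
theorem theorem4p7 (p : ℕ) [Fact p.Prime] (ι : ℂ ≃+* PadicAlgCl p) (z : ℂ)
    (hz : 0 < z.im) (hzp : InfPCF.MemQp ι z) (hquad : (minpoly ℚ z).natDegree = 2) :
    (∃ E : InfPCF.Run, InfPCF.IsExpansion ι z E) ∧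
      ∀ E : InfPCF.Run, InfPCF.IsExpansion ι z E →
        ∃ k l : ℕ, 1 ≤ k ∧ k < l ∧ E.x k = E.x l := by
  obtain ⟨D, A, h⟩ := InfPCF.exists_isFormRoot hz hquad
  exact ⟨InfPCF.exists_isExpansion h hzp, fun E hE => hE.exists_eq h⟩
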